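/- Let $N$ be a finite index set and let $(N^+,N^-)$ be a partition of $N$ into two disjoint, possibly empty, sets. For a vector $c$ and an index set $S$ write $c(S)=\sum_{i\in S}c_i$. Let $$X=\Big\{(x,y,t)\in\{0,1\}^N\times\mathbb{R}_+^N\times\mathbb{R}_+:\ \big(y(N^+)-y(N^-)\big)^2\le t,\ \ y_i(1-x_i)=0\ \text{ for all } i\in N\Big\}.$$ Use the conventions $a/0=\infty$ for $a>0$ and $0/0=0$. For pairwise disjoint (possibly empty) sets $M,L,R,U\subseteq N$, consider the inequality $$t\ \ge\ \min_{\lambda,\mu,\lambda_0,\mu_0,\zeta}\ \frac{\big(y(L)-\lambda_0\big)^2}{1-x(R)-x(U)+\mu(R)+\mu_0}+\sum_{i\in R}\frac{(y_i-\lambda_i)^2}{x_i-\mu_i}+\frac{\big(y(U)-y(M)+\lambda_0+\lambda(R)+\zeta\big)^2}{x(U)-\mu_0}\qquad (I_{M;L,R,U})$$ where the minimum (a value in $[0,\infty]$) is over all $\lambda,\mu\in\mathbb{R}_+^R$ and $\lambda_0,\mu_0,\zeta\in\mathbb{R}_+$ satisfying $$1-x(R)-x(U)+\mu(R)+\mu_0\ge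 0,\qquad \mu_i\le x_i\ \ (i\in R),\qquad \mu_0\le x(U).$$ Then the closure of the convex hull of $X$ is exactly the set of all $(x,y,t)\in\mathbb{R}^N\times\mathbb{R}^N\times\mathbb{R}$ such that $0\le x_i\le 1$ and $y_i\ge 0$ for all $i\in N$, such that $(I_{N^-;L,R,U})$ holds for every partition $(L,R,U)$ of $N^+$ (parts may be empty), and such that $(I_{N^+;L,R,U})$ holds for every partition $(L,R,U)$ of $N^-$ (parts may be empty); at every point of this set each of these minima is attained. -/

import Mathlib

/-- The mixed-integer epigraph `X` of the rank-one quadratic `(y(N⁺) - y(N⁻))²` with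
nonnegative continuous variables `y` and indicator variables `x`; its points are triples
`(x, y, t)`. -/
def rankOneSet {ι : Type*} (Np Nm : Finset ι) : Set ((ι → ℝ) × (ι → ℝ) × ℝ) :=
  {p | (∀ i, p.1 i = 0 ∨ p.1 i = 1) ∧ (∀ i, 0 ≤ p.2.1 i) ∧ 0 ≤ p.2.2 ∧
    ((∑ i ∈ Np, p.2.1 i) - ∑ i ∈ Nm, p.2.1 i) ^ 2 ≤ p.2.2 ∧
    ∀ i, p.2.1 i * (1 - p.1 i) = 0}

/-- `(L, R, U)` is a partition of `S`; parts may be empty. -/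
structure IsTripartition {ι : Type*} [DecidableEq ι] (S L R U : Finset ι) : Prop where
  disjoint_L_R : Disjoint L R
  disjoint_L_U : Disjoint L U
  disjoint_R_U : Disjoint R U
  union_eq : L ∪ R ∪ U = S

/-- The extended-valued quotient `a / b` with `a / 0 = ∞` for `a > 0` and `0 / 0 = 0`.
It is only used with `0 ≤ a` and `0 ≤ b`. -/
noncomputable def extQuot (a b : ℝ) : EReal :=
  if b = 0 then (if a = 0 then 0 else ⊤) else ((a / b : ℝ) : EReal)

/-- The constraints on the auxiliary variables `(λ, μ, λ₀, μ₀, ζ)`. The vectors `λ, μ` are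
indexed by `R`: only their entries in `R` occur, here and in the objective. -/
structure AuxFeasible {ι : Type*} (R U : Finset ι) (x : ι → ℝ)
    (lam mu : ι → ℝ) (lam0 mu0 zeta : ℝ) : Prop where
  denom_nonneg : 0 ≤ 1 - (∑ i ∈ R, x i) - (∑ i ∈ U, x i) + (∑ i ∈ R, mu i) + mu0
  mu_le : ∀ i ∈ R, mu i ≤ x i
  mu0_le : mu0 ≤ ∑ i ∈ U, x i
  lam_nonneg : ∀ i ∈ R, 0 ≤ lam i
  mu_nonneg : ∀ i ∈ R, 0 ≤ mu i
  lam0_nonneg : 0 ≤ lam0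
  mu0_nonneg : 0 ≤ mu0
  zeta_nonneg : 0 ≤ zeta

/-- The objective, a sum of ratios of convex quadratic and nonnegative linear terms.
Here `(L, R, U)` partitions one of the two sides `N⁺`, `N⁻`, and `M` is the other side. -/
noncomputable def auxObjective {ι : Type*} (M L R U : Finset ι) (x y : ι → ℝ)
    (lam mu : ι → ℝ) (lam0 mu0 zeta : ℝ) : EReal :=
  extQuot (((∑ i ∈ L, y i) - lam0) ^ 2)
      (1 - (∑ i ∈ R, x i) - (∑ i ∈ U, x i) + (∑ i ∈ R, mu i) + mu0)
    + (∑ i ∈ R, extQuot ((y i - lam i) ^ 2) (x i - mu i))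
    + extQuot (((∑ i ∈ U, y i) - (∑ i ∈ M, y i) + lam0 + (∑ i ∈ R, lam i) + zeta) ^ 2)
      ((∑ i ∈ U, x i) - mu0)

/-- The inequality `t ≥ min_{λ, μ, λ₀, μ₀, ζ} (objective)` over the feasible auxiliary variables:
the minimum exists in the extended reals and is at most `t`. -/
def ExtendedIneq {ι : Type*} (M L R U : Finset ι) (x y : ι → ℝ) (t : ℝ) : Prop :=
  ∃ v : EReal,
    IsLeast {w : EReal | ∃ (lam mu : ι → ℝ) (lam0 mu0 zeta : ℝ),
      AuxFeasible R U x lam mu lam0 mu0 zeta ∧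
      w = auxObjective M L R U x y lam mu lam0 mu0 zeta} v ∧
    v ≤ (t : EReal)

/-! ### Extended-valued quotients as rotated cone constraints. -/

open Filter Topology

/-! A bound `a / b ≤ r` is the rotated cone condition `0 ≤ r`, `a ≤ r * b`. So each inequality says
that `(x, y, t)` has a certificate, a point in the fibre of a convex set. The fibres are bounded, so
the projection is closed over `x, y ≥ 0` and minima are attained (`extendedIneq_iff`). Explicit
multipliers certify every point of `X`, giving one inclusion.

Conversely, let `N⁺` be the side of larger total and take only `R = N⁺`. The third denominator is
then 0, so `λ(N⁺) ≤ y(N⁻)`, and the numbers `d i = x i - μ i` have sum at most 1: they are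
probabilities of disjoint events. Scaling the positive parts of `y - λ` gives `z ≤ y` on `N⁺` with
total `s = y(N⁺) - y(N⁻)`. Switching on one `z i` per event puts `(x, z, t)` in the hull
(`mem_convexHull_rankOneSet`). The rest `y - z` has equal totals on both sides, hence is a recession
direction (`add_balanced_mem_closure`). -/

lemma extQuot_nonneg {a b : ℝ} (ha : 0 ≤ a) (hb : 0 ≤ b) : 0 ≤ extQuot a b := by
  unfold extQuot
  split_ifs
  · exact le_rfl
  · exact le_top
  · exact_mod_cast div_nonneg ha hb

lemma extQuot_le_coe_iff {a b r : ℝ} (ha : 0 ≤ a) (hb : 0 ≤ b) :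
    extQuot a b ≤ (r : EReal) ↔ 0 ≤ r ∧ a ≤ r * b := by
  unfold extQuot
  split_ifs with h1 h2
  · subst h1 h2; simp
  · subst h1
    constructor
    · intro h; exact absurd (top_le_iff.1 h) (EReal.coe_ne_top r)
    · rintro ⟨-, h⟩; exact absurd (le_antisymm (by simpa using h) ha) h2
  · have hb' : 0 < b := lt_of_le_of_ne hb (Ne.symm h1)
    rw [EReal.coe_le_coe_iff, div_le_iff₀ hb']
    refine ⟨fun h => ⟨?_, h⟩, fun h => h.2⟩
    by_contra! hr
    nlinarith

lemma EReal.exists_coe_of_nonneg_of_le {e : EReal} {t : ℝ} (h0 : 0 ≤ e) (h : e ≤ t) :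
    ∃ r : ℝ, e = r :=
  ⟨e.toReal, (EReal.coe_toReal (ne_top_of_le_ne_top (EReal.coe_ne_top t) h)
    (ne_bot_of_le_ne_bot EReal.zero_ne_bot h0)).symm⟩

lemma EReal.coe_finset_sum {ι : Type*} (s : Finset ι) (f : ι → ℝ) :
    ((∑ i ∈ s, f i : ℝ) : EReal) = ∑ i ∈ s, (f i : EReal) := by
  classical
  induction s using Finset.induction_on with
  | empty => simp
  | insert a s ha ih => simp [Finset.sum_insert ha, ih]

/-! ### Certificates: boundedness, closedness, convexity, attainment. -/

section Certificate

variable {ι : Type*}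

/-- A real certificate for `auxObjective ≤ t`: the three kinds of ratios are bounded by
`t0`, `tau i` and `tU`, through rotated second-order cone constraints. -/
def AuxCertificate (M L R U : Finset ι) (x y : ι → ℝ) (t : ℝ)
    (lam mu tau : ι → ℝ) (lam0 mu0 zeta t0 tU : ℝ) : Prop :=
  AuxFeasible R U x lam mu lam0 mu0 zeta ∧
  (∀ i ∉ R, lam i = 0 ∧ mu i = 0 ∧ tau i = 0) ∧
  (∀ i ∈ R, 0 ≤ tau i ∧ (y i - lam i) ^ 2 ≤ tau i * (x i - mu i)) ∧
  0 ≤ t0 ∧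
  ((∑ i ∈ L, y i) - lam0) ^ 2 ≤
    t0 * (1 - (∑ i ∈ R, x i) - (∑ i ∈ U, x i) + (∑ i ∈ R, mu i) + mu0) ∧
  0 ≤ tU ∧
  ((∑ i ∈ U, y i) - (∑ i ∈ M, y i) + lam0 + (∑ i ∈ R, lam i) + zeta) ^ 2 ≤
    tU * ((∑ i ∈ U, x i) - mu0) ∧
  t0 + (∑ i ∈ R, tau i) + tU ≤ t

/-- The points `(x, y, t)` having a certificate. -/
def certifiedSet (M L R U : Finset ι) : Set ((ι → ℝ) × (ι → ℝ) × ℝ) :=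
  {p | ∃ (lam mu tau : ι → ℝ) (lam0 mu0 zeta t0 tU : ℝ),
    AuxCertificate M L R U p.1 p.2.1 p.2.2 lam mu tau lam0 mu0 zeta t0 tU}

lemma AuxCertificate.auxObjective_le {M L R U : Finset ι} {x y : ι → ℝ} {t : ℝ}
    {lam mu tau : ι → ℝ} {lam0 mu0 zeta t0 tU : ℝ}
    (h : AuxCertificate M L R U x y t lam mu tau lam0 mu0 zeta t0 tU) :
    auxObjective M L R U x y lam mu lam0 mu0 zeta ≤ t := by
  obtain ⟨hf, -, hR, h0, h0', hU, hU', ht⟩ := h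
  refine le_trans ?_ (EReal.coe_le_coe_iff.2 ht)
  rw [EReal.coe_add, EReal.coe_add, EReal.coe_finset_sum]
  refine add_le_add (add_le_add ?_ (Finset.sum_le_sum fun i hi => ?_)) ?_
  · exact (extQuot_le_coe_iff (sq_nonneg _) hf.denom_nonneg).2 ⟨h0, h0'⟩
  · exact (extQuot_le_coe_iff (sq_nonneg _) (sub_nonneg.2 (hf.mu_le i hi))).2 (hR i hi)
  · exact (extQuot_le_coe_iff (sq_nonneg _) (sub_nonneg.2 hf.mu0_le)).2 ⟨hU, hU'⟩

lemma AuxFeasible.auxObjective_nonneg {M L R U : Finset ι} {x y lam mu : ι → ℝ}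
    {lam0 mu0 zeta : ℝ} (hf : AuxFeasible R U x lam mu lam0 mu0 zeta) :
    0 ≤ auxObjective M L R U x y lam mu lam0 mu0 zeta :=
  add_nonneg (add_nonneg (extQuot_nonneg (sq_nonneg _) hf.denom_nonneg)
    (Finset.sum_nonneg fun i hi =>
      extQuot_nonneg (sq_nonneg _) (sub_nonneg.2 (hf.mu_le i hi))))
    (extQuot_nonneg (sq_nonneg _) (sub_nonneg.2 hf.mu0_le))

/-- The summands are nonnegative, so a finite bound on their sum makes each of them real; these
values serve as `t0`, `tau` and `tU`. -/
lemma AuxFeasible.mem_certifiedSet [DecidableEq ι] {M L R U : Finset ι} {x y : ι → ℝ} {t : ℝ}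
    {lam mu : ι → ℝ} {lam0 mu0 zeta : ℝ} (hf : AuxFeasible R U x lam mu lam0 mu0 zeta)
    (h : auxObjective M L R U x y lam mu lam0 mu0 zeta ≤ t) :
    (x, y, t) ∈ certifiedSet M L R U := by
  unfold auxObjective at h
  set A := extQuot (((∑ i ∈ L, y i) - lam0) ^ 2)
      (1 - (∑ i ∈ R, x i) - (∑ i ∈ U, x i) + (∑ i ∈ R, mu i) + mu0) with hA
  set B : ι → EReal := fun i => extQuot ((y i - lam i) ^ 2) (x i - mu i) with hB
  set D := extQuot (((∑ i ∈ U, y i) - (∑ i ∈ M, y i) + lam0 + (∑ i ∈ R, lam i) + zeta) ^ 2)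
      ((∑ i ∈ U, x i) - mu0) with hD
  have hA0 : 0 ≤ A := extQuot_nonneg (sq_nonneg _) hf.denom_nonneg
  have hB0 : ∀ i ∈ R, 0 ≤ B i := fun i hi =>
    extQuot_nonneg (sq_nonneg _) (sub_nonneg.2 (hf.mu_le i hi))
  have hS0 : 0 ≤ ∑ i ∈ R, B i := Finset.sum_nonneg hB0
  have hD0 : 0 ≤ D := extQuot_nonneg (sq_nonneg _) (sub_nonneg.2 hf.mu0_le)
  have hAB : A + ∑ i ∈ R, B i ≤ t := le_trans (le_add_of_nonneg_right hD0) h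
  have hS : ∑ i ∈ R, B i ≤ t := le_trans (le_add_of_nonneg_left hA0) hAB
  obtain ⟨a, ha⟩ := EReal.exists_coe_of_nonneg_of_le hA0
    (le_trans (le_add_of_nonneg_right hS0) hAB)
  obtain ⟨d, hd⟩ := EReal.exists_coe_of_nonneg_of_le hD0
    (le_trans (le_add_of_nonneg_left (add_nonneg hA0 hS0)) h)
  have hBr : ∀ i, ∃ r : ℝ, i ∈ R → B i = r := fun i => by
    by_cases hi : i ∈ R
    · obtain ⟨r, hr⟩ := EReal.exists_coe_of_nonneg_of_le (hB0 i hi)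
        (le_trans (Finset.single_le_sum hB0 hi) hS)
      exact ⟨r, fun _ => hr⟩
    · exact ⟨0, fun h => absurd h hi⟩
  choose b hb using hBr
  rw [Finset.sum_congr rfl hb, ha, hd, ← EReal.coe_finset_sum, ← EReal.coe_add,
    ← EReal.coe_add, EReal.coe_le_coe_iff] at h
  have hite : ∀ f : ι → ℝ, ∑ i ∈ R, (if i ∈ R then f i else 0) = ∑ i ∈ R, f i := fun f =>
    Finset.sum_congr rfl fun i hi => if_pos hi
  have hA' := (extQuot_le_coe_iff (sq_nonneg _) hf.denom_nonneg).1 (hA.symm.trans ha).le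
  have hD' := (extQuot_le_coe_iff (sq_nonneg _) (sub_nonneg.2 hf.mu0_le)).1
    (hD.symm.trans hd).le
  -- Entries off `R` are free in the objective; setting them to zero keeps the fibres of
  -- certificates bounded.
  refine ⟨fun i => if i ∈ R then lam i else 0, fun i => if i ∈ R then mu i else 0,
    fun i => if i ∈ R then b i else 0, lam0, mu0, zeta, a, d, ?_⟩
  refine ⟨⟨?_, ?_, hf.mu0_le, ?_, ?_, hf.lam0_nonneg, hf.mu0_nonneg, hf.zeta_nonneg⟩,
    ?_, ?_, hA'.1, ?_, hD'.1, ?_, ?_⟩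
  · simpa only [hite] using hf.denom_nonneg
  · intro i hi; simpa [hi] using hf.mu_le i hi
  · intro i hi; simpa [hi] using hf.lam_nonneg i hi
  · intro i hi; simpa [hi] using hf.mu_nonneg i hi
  · intro i hi; simp [hi]
  · intro i hi
    simpa [hi] using (extQuot_le_coe_iff (sq_nonneg _)
      (sub_nonneg.2 (hf.mu_le i hi))).1 (hb i hi).le
  · simpa only [hite] using hA'.2
  · simpa only [hite] using hD'.2
  · simpa only [hite] using h

/-- All components of a certificate are bounded in terms of the point it certifies. -/
lemma AuxCertificate.bounds {M L R U : Finset ι} {x y : ι → ℝ} {t : ℝ}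
    {lam mu tau : ι → ℝ} {lam0 mu0 zeta t0 tU : ℝ}
    (h : AuxCertificate M L R U x y t lam mu tau lam0 mu0 zeta t0 tU)
    (hx : ∀ i, 0 ≤ x i) (hy : ∀ i, 0 ≤ y i) :
    (0 ≤ lam ∧ lam ≤ fun i => y i + 1 + t) ∧ (0 ≤ mu ∧ mu ≤ x) ∧
    (0 ≤ tau ∧ tau ≤ fun _ => t) ∧ (0 ≤ lam0 ∧ lam0 ≤ (∑ i ∈ L, y i) + 1 + t) ∧
    (0 ≤ mu0 ∧ mu0 ≤ ∑ i ∈ U, x i) ∧ (0 ≤ zeta ∧ zeta ≤ (∑ i ∈ M, y i) + 1 + t) ∧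
    (0 ≤ t0 ∧ t0 ≤ t) ∧ (0 ≤ tU ∧ tU ≤ t) := by
  obtain ⟨hf, hout, hR, h0, h0', hU, hU', ht⟩ := h
  have htau : ∀ i, 0 ≤ tau i := fun i => by
    by_cases hi : i ∈ R
    · exact (hR i hi).1
    · rw [(hout i hi).2.2]
  have hsum : 0 ≤ ∑ i ∈ R, tau i := Finset.sum_nonneg fun i _ => htau i
  have ht_nonneg : 0 ≤ t := by linarith
  have hd : ∀ i ∈ R, 0 ≤ x i - mu i := fun i hi => sub_nonneg.2 (hf.mu_le i hi)
  have hdsum : 0 ≤ ∑ i ∈ R, (x i - mu i) := Finset.sum_nonneg hd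
  have hdU := hf.mu0_le
  have hd0 := hf.denom_nonneg
  have hdsum' := hdsum
  rw [Finset.sum_sub_distrib] at hdsum'
  -- All the denominators together sum to 1 and are nonnegative, so each is at most 1 and each
  -- squared numerator is at most `t`.
  have key : ∀ a b r : ℝ, 0 ≤ r → r ≤ t → b ≤ 1 → a ^ 2 ≤ r * b → |a| ≤ 1 + t := by
    intro a b r hr hrt hb hab
    have h1 : a ^ 2 ≤ t := hab.trans ((mul_le_of_le_one_right hr hb).trans hrt)
    have h2 : |a| ≤ 1 + a ^ 2 := by
      rw [← sq_abs]; nlinarith [sq_nonneg (|a| - 1), abs_nonneg a]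
    linarith
  have htau_le : ∀ i, tau i ≤ t := fun i => by
    by_cases hi : i ∈ R
    · have := Finset.single_le_sum (fun j _ => htau j) hi
      linarith
    · rw [(hout i hi).2.2]; exact ht_nonneg
  refine ⟨⟨fun i => ?_, fun i => ?_⟩, ⟨fun i => ?_, fun i => ?_⟩, ⟨htau, htau_le⟩,
    ⟨hf.lam0_nonneg, ?_⟩, ⟨hf.mu0_nonneg, hdU⟩, ⟨hf.zeta_nonneg, ?_⟩, ⟨h0, by linarith⟩,
    ⟨hU, by linarith⟩⟩
  · by_cases hi : i ∈ R
    · exact hf.lam_nonneg i hi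
    · exact (hout i hi).1.ge
  · by_cases hi : i ∈ R
    · have h1 : x i - mu i ≤ 1 := by
        have := Finset.single_le_sum hd hi
        rw [Finset.sum_sub_distrib] at this
        linarith
      have := (abs_le.1 (key _ _ _ (htau i) (htau_le i) h1 (hR i hi).2)).1
      show lam i ≤ y i + 1 + t
      linarith
    · show lam i ≤ y i + 1 + t
      rw [(hout i hi).1]
      linarith [hy i]
  · by_cases hi : i ∈ R
    · exact hf.mu_nonneg i hi
    · exact (hout i hi).2.1.ge
  · by_cases hi : i ∈ R
    · exact hf.mu_le i hi
    · rw [(hout i hi).2.1]; exact hx i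
  · have := (abs_le.1 (key _ _ _ h0 (by linarith) (by linarith) h0')).1
    linarith
  · have := (abs_le.1 (key _ _ _ hU (by linarith) (by linarith) hU')).2
    have h1 : 0 ≤ ∑ i ∈ U, y i := Finset.sum_nonneg fun i _ => hy i
    have h2 : 0 ≤ ∑ i ∈ R, lam i := Finset.sum_nonneg hf.lam_nonneg
    linarith [hf.lam0_nonneg]

/-- A projection of a closed set along order-bounded fibres is closed. -/
lemma isClosed_exists_of_mem_Icc {P A : Type*} [TopologicalSpace P] [FirstCountableTopology P]
    [TopologicalSpace A] [FirstCountableTopology A] [Lattice A] [CompactIccSpace A]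
    [BoundedLENhdsClass A] {C : Set (P × A)} (hC : IsClosed C) (c : A) {b : P → A}
    (hb : Continuous b) (h : ∀ q ∈ C, q.2 ∈ Set.Icc c (b q.1)) :
    IsClosed {p | ∃ a, (p, a) ∈ C} := by
  refine IsSeqClosed.isClosed fun u p hu hup => ?_
  choose a ha using hu
  obtain ⟨B, hB⟩ := ((hb.tendsto p).comp hup).bddAbove_range
  have hmem : ∀ n, a n ∈ Set.Icc c B := fun n =>
    ⟨(h _ (ha n)).1, (h _ (ha n)).2.trans (hB ⟨n, rfl⟩)⟩
  obtain ⟨l, -, φ, hφ, hl⟩ := isCompact_Icc.tendsto_subseq hmem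
  exact ⟨l, hC.mem_of_tendsto ((hup.comp hφ.tendsto_atTop).prodMk_nhds hl)
    (Eventually.of_forall fun n => ha (φ n))⟩

/-- The sign conditions on `x` and `y` are included because the bounds on certificates rely on them.
-/
lemma isClosed_certifiedSet [Finite ι] (M L R U : Finset ι) :
    IsClosed {p : (ι → ℝ) × (ι → ℝ) × ℝ |
      ((∀ i, 0 ≤ p.1 i) ∧ ∀ i, 0 ≤ p.2.1 i) ∧ p ∈ certifiedSet M L R U} := by
  have := Fintype.ofFinite ι
  let C : Set (((ι → ℝ) × (ι → ℝ) × ℝ) ×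
      ((ι → ℝ) × (ι → ℝ) × (ι → ℝ) × ℝ × ℝ × ℝ × ℝ × ℝ)) :=
    {q | ((∀ i, 0 ≤ q.1.1 i) ∧ ∀ i, 0 ≤ q.1.2.1 i) ∧
      AuxCertificate M L R U q.1.1 q.1.2.1 q.1.2.2 q.2.1 q.2.2.1 q.2.2.2.1 q.2.2.2.2.1
        q.2.2.2.2.2.1 q.2.2.2.2.2.2.1 q.2.2.2.2.2.2.2.1 q.2.2.2.2.2.2.2.2}
  have hfeas : ∀ (x lam mu : ι → ℝ) (lam0 mu0 zeta : ℝ),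
      AuxFeasible R U x lam mu lam0 mu0 zeta ↔
        0 ≤ 1 - (∑ i ∈ R, x i) - (∑ i ∈ U, x i) + (∑ i ∈ R, mu i) + mu0 ∧
        (∀ i ∈ R, mu i ≤ x i) ∧ mu0 ≤ ∑ i ∈ U, x i ∧ (∀ i ∈ R, 0 ≤ lam i) ∧
        (∀ i ∈ R, 0 ≤ mu i) ∧ 0 ≤ lam0 ∧ 0 ≤ mu0 ∧ 0 ≤ zeta := fun _ _ _ _ _ _ =>
    ⟨fun h => ⟨h.1, h.2, h.3, h.4, h.5, h.6, h.7, h.8⟩,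
      fun ⟨h1, h2, h3, h4, h5, h6, h7, h8⟩ => ⟨h1, h2, h3, h4, h5, h6, h7, h8⟩⟩
  have hC : IsClosed C := by
    simp only [C, AuxCertificate, hfeas, Set.ofPred_and, Set.ofPred_forall]
    repeat' first
      | apply IsClosed.inter
      | (refine isClosed_iInter fun i => ?_)
      | exact isClosed_le (by fun_prop) (by fun_prop)
      | exact isClosed_eq (by fun_prop) (by fun_prop)
  have hb : Continuous (fun p : (ι → ℝ) × (ι → ℝ) × ℝ =>
      ((fun i => p.2.1 i + 1 + p.2.2, p.1, fun _ => p.2.2, (∑ i ∈ L, p.2.1 i) + 1 + p.2.2,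
        ∑ i ∈ U, p.1 i, (∑ i ∈ M, p.2.1 i) + 1 + p.2.2, p.2.2, p.2.2) :
        (ι → ℝ) × (ι → ℝ) × (ι → ℝ) × ℝ × ℝ × ℝ × ℝ × ℝ)) := by fun_prop
  convert isClosed_exists_of_mem_Icc hC 0 hb ?_ using 1
  · ext p
    constructor
    · rintro ⟨hp, lam, mu, tau, lam0, mu0, zeta, t0, tU, h⟩
      exact ⟨(lam, mu, tau, lam0, mu0, zeta, t0, tU), hp, h⟩
    · rintro ⟨⟨lam, mu, tau, lam0, mu0, zeta, t0, tU⟩, hp, h⟩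
      exact ⟨hp, lam, mu, tau, lam0, mu0, zeta, t0, tU, h⟩
  · rintro ⟨⟨x, y, t⟩, lam, mu, tau, lam0, mu0, zeta, t0, tU⟩ ⟨⟨hx, hy⟩, h⟩
    obtain ⟨h1, h2, h3, h4, h5, h6, h7, h8⟩ := h.bounds hx hy
    exact ⟨⟨h1.1, h2.1, h3.1, h4.1, h5.1, h6.1, h7.1, h8.1⟩,
      ⟨h1.2, h2.2, h3.2, h4.2, h5.2, h6.2, h7.2, h8.2⟩⟩

/-- Convexity of the rotated cone: by AM-GM the cross term satisfies `2aa' ≤ rd' + r'd`. -/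
lemma sq_le_mul_convex_comb {a a' r r' d d' u v : ℝ} (hr : 0 ≤ r) (hr' : 0 ≤ r') (hd : 0 ≤ d)
    (hd' : 0 ≤ d') (hu : 0 ≤ u) (hv : 0 ≤ v) (h : a ^ 2 ≤ r * d) (h' : a' ^ 2 ≤ r' * d') :
    (u * a + v * a') ^ 2 ≤ (u * r + v * r') * (u * d + v * d') := by
  have hcross : 2 * (a * a') ≤ r * d' + r' * d := by
    have h1 : (a * a') ^ 2 ≤ (r * d') * (r' * d) := by
      calc (a * a') ^ 2 = a ^ 2 * a' ^ 2 := by ring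
        _ ≤ (r * d) * (r' * d') := mul_le_mul h h' (sq_nonneg _) (mul_nonneg hr hd)
        _ = _ := by ring
    have h2 : (2 * (a * a')) ^ 2 ≤ (r * d' + r' * d) ^ 2 := by
      nlinarith [sq_nonneg (r * d' - r' * d)]
    exact (le_abs_self _).trans
      (abs_le_of_sq_le_sq h2 (add_nonneg (mul_nonneg hr hd') (mul_nonneg hr' hd)))
  nlinarith [mul_le_mul_of_nonneg_left h (sq_nonneg u),
    mul_le_mul_of_nonneg_left h' (sq_nonneg v),
    mul_le_mul_of_nonneg_left hcross (mul_nonneg hu hv)]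

lemma convex_certifiedSet (M L R U : Finset ι) : Convex ℝ (certifiedSet M L R U) := by
  rintro ⟨x, y, t⟩ ⟨lam, mu, tau, lam0, mu0, zeta, t0, tU, hf, ho, hR, h0, h0', hU, hU', ht⟩
    ⟨x', y', t'⟩ ⟨lam', mu', tau', lam0', mu0', zeta', t0', tU', hf', ho', hR', k0, k0', kU, kU',
      ht'⟩ u v hu hv huv
  have hsum : ∀ (s : Finset ι) (f g : ι → ℝ),
      ∑ i ∈ s, (u * f i + v * g i) = u * ∑ i ∈ s, f i + v * ∑ i ∈ s, g i := fun s f g => by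
    rw [Finset.sum_add_distrib, Finset.mul_sum, Finset.mul_sum]
  have hmix : ∀ {a b : ℝ}, 0 ≤ a → 0 ≤ b → 0 ≤ u * a + v * b := fun ha hb =>
    add_nonneg (mul_nonneg hu ha) (mul_nonneg hv hb)
  have hle : ∀ {a b a' b' : ℝ}, a ≤ b → a' ≤ b' → u * a + v * a' ≤ u * b + v * b' :=
    fun ha hb => add_le_add (mul_le_mul_of_nonneg_left ha hu) (mul_le_mul_of_nonneg_left hb hv)
  have hv1 : v = 1 - u := by linarith
  refine ⟨fun i => u * lam i + v * lam' i, fun i => u * mu i + v * mu' i,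
    fun i => u * tau i + v * tau' i, u * lam0 + v * lam0', u * mu0 + v * mu0',
    u * zeta + v * zeta', u * t0 + v * t0', u * tU + v * tU', ⟨?_, ?_, ?_, ?_, ?_, ?_, ?_, ?_⟩,
    ?_, ?_, hmix h0 k0, ?_, hmix hU kU, ?_, ?_⟩
  all_goals try simp only [Prod.fst_add, Prod.snd_add, Prod.smul_fst, Prod.smul_snd, Pi.add_apply,
    Pi.smul_apply, smul_eq_mul, hsum]
  · refine (hmix hf.denom_nonneg hf'.denom_nonneg).trans_eq ?_
    rw [hv1]; ring
  · exact fun i hi => hle (hf.mu_le i hi) (hf'.mu_le i hi)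
  · exact hle hf.mu0_le hf'.mu0_le
  · exact fun i hi => hmix (hf.lam_nonneg i hi) (hf'.lam_nonneg i hi)
  · exact fun i hi => hmix (hf.mu_nonneg i hi) (hf'.mu_nonneg i hi)
  · exact hmix hf.lam0_nonneg hf'.lam0_nonneg
  · exact hmix hf.mu0_nonneg hf'.mu0_nonneg
  · exact hmix hf.zeta_nonneg hf'.zeta_nonneg
  · intro i hi
    obtain ⟨h1, h2, h3⟩ := ho i hi
    obtain ⟨k1, k2, k3⟩ := ho' i hi
    simp [h1, h2, h3, k1, k2, k3]
  · intro i hi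
    refine ⟨hmix (hR i hi).1 (hR' i hi).1, ?_⟩
    convert sq_le_mul_convex_comb (hR i hi).1 (hR' i hi).1 (sub_nonneg.2 (hf.mu_le i hi))
      (sub_nonneg.2 (hf'.mu_le i hi)) hu hv (hR i hi).2 (hR' i hi).2 using 1 <;> ring
  · convert sq_le_mul_convex_comb h0 k0 hf.denom_nonneg hf'.denom_nonneg hu hv h0' k0' using 1
    · ring
    · rw [hv1]; ring
  · convert sq_le_mul_convex_comb hU kU (sub_nonneg.2 hf.mu0_le) (sub_nonneg.2 hf'.mu0_le)
      hu hv hU' kU' using 1 <;> ring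
  · refine le_trans (le_of_eq ?_) (hle ht ht')
    ring

/-- The minimum in `ExtendedIneq` is attained as soon as some value is finite. -/
lemma extendedIneq_iff [Finite ι] [DecidableEq ι] {M L R U : Finset ι} {x y : ι → ℝ} {t : ℝ}
    (hx : ∀ i, 0 ≤ x i) (hy : ∀ i, 0 ≤ y i) :
    ExtendedIneq M L R U x y t ↔ (x, y, t) ∈ certifiedSet M L R U := by
  constructor
  · rintro ⟨v, ⟨⟨lam, mu, lam0, mu0, zeta, hf, rfl⟩, -⟩, hv⟩
    exact hf.mem_certifiedSet hv
  · intro h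
    -- The certified levels over fixed `(x, y)` form a closed set bounded below. A certificate at
    -- the infimum is a minimizer: a smaller objective value would be real and itself a level.
    let T : Set ℝ := {r | ((∀ i, 0 ≤ x i) ∧ ∀ i, 0 ≤ y i) ∧ (x, y, r) ∈ certifiedSet M L R U}
    have hT : IsClosed T := (isClosed_certifiedSet M L R U).preimage
      (f := fun r : ℝ => (x, y, r)) (by fun_prop)
    have hT0 : ∀ r ∈ T, 0 ≤ r := by
      rintro r ⟨-, _, _, _, _, _, _, _, _, hc⟩
      have hb := hc.bounds hx hy
      exact hb.2.2.2.2.2.2.1.1.trans hb.2.2.2.2.2.2.1.2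
    have htT : t ∈ T := ⟨⟨hx, hy⟩, h⟩
    have hbdd : BddBelow T := ⟨0, hT0⟩
    obtain ⟨-, lam, mu, tau, lam0, mu0, zeta, t0, tU, hc⟩ := hT.csInf_mem ⟨t, htT⟩ hbdd
    refine ⟨auxObjective M L R U x y lam mu lam0 mu0 zeta,
      ⟨⟨lam, mu, lam0, mu0, zeta, hc.1, rfl⟩, ?_⟩,
      hc.auxObjective_le.trans (EReal.coe_le_coe_iff.2 (csInf_le hbdd htT))⟩
    rintro w ⟨lam', mu', lam0', mu0', zeta', hf', rfl⟩
    refine hc.auxObjective_le.trans ?_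
    by_contra! hlt
    obtain ⟨r, hr⟩ := EReal.exists_coe_of_nonneg_of_le
      (hf'.auxObjective_nonneg (M := M) (L := L) (y := y)) hlt.le
    rw [hr] at hlt
    exact absurd (csInf_le hbdd ⟨⟨hx, hy⟩, hf'.mem_certifiedSet hr.le⟩)
      (not_le.2 (EReal.coe_lt_coe_iff.1 hlt))

end Certificate

/-! ### The hull of `X`: certifying its points, and building hull points. -/

section Hull

variable {ι : Type*}

lemma rankOneSet_comm (Np Nm : Finset ι) : rankOneSet Np Nm = rankOneSet Nm Np := by
  ext p
  simp only [rankOneSet, Set.mem_ofPred_eq, sub_sq_comm (∑ i ∈ Np, p.2.1 i)]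

/-- For a point of the rank-one set, every ratio can be taken equal to the total surplus
`s = y(S) - y(M)`, or to zero if `s ≤ 0`. -/
lemma rankOneSet_subset_certifiedSet [DecidableEq ι] {S M L R U : Finset ι} (h : IsTripartition S L R U) :
    rankOneSet S M ⊆ certifiedSet M L R U := by
  rintro ⟨x, y, t⟩ ⟨hx, hy, ht0, ht, hxy⟩
  simp only at hx hy ht0 ht hxy
  have hx0 : ∀ i, 0 ≤ x i := fun i => by rcases hx i with h | h <;> rw [h]; exact zero_le_one
  have hS : ∑ i ∈ S, y i = ∑ i ∈ L, y i + ∑ i ∈ R, y i + ∑ i ∈ U, y i := by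
    rw [← h.union_eq, Finset.sum_union, Finset.sum_union h.disjoint_L_R]
    exact Finset.disjoint_union_left.2 ⟨h.disjoint_L_U, h.disjoint_R_U⟩
  have hsum_nonneg : ∀ s : Finset ι, 0 ≤ ∑ i ∈ s, y i := fun s =>
    Finset.sum_nonneg fun i _ => hy i
  have hxU : ∑ i ∈ U, x i = 0 ∨ 1 ≤ ∑ i ∈ U, x i := by
    by_cases hex : ∃ i ∈ U, x i = 1
    · obtain ⟨i, hi, hi1⟩ := hex
      exact Or.inr (hi1 ▸ Finset.single_le_sum (fun j _ => hx0 j) hi)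
    · push Not at hex
      exact Or.inl (Finset.sum_eq_zero fun i hi => (hx i).resolve_right (hex i hi))
  rcases hxU with hU0 | hU1
  · have hyU : ∑ i ∈ U, y i = 0 := Finset.sum_eq_zero fun i hi => by
      have := (Finset.sum_eq_zero_iff_of_nonneg fun j _ => hx0 j).1 hU0 i hi
      simpa [this] using hxy i
    rcases le_or_gt (∑ i ∈ S, y i) (∑ i ∈ M, y i) with hs | hs
    -- No surplus: `ζ` absorbs the deficit and every numerator vanishes.
    · refine AuxFeasible.mem_certifiedSet (lam := y) (mu := x) (lam0 := ∑ i ∈ L, y i) (mu0 := 0)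
        (zeta := (∑ i ∈ M, y i) - ∑ i ∈ S, y i) ⟨?_, fun i _ => le_rfl, hU0.ge, fun i _ => hy i,
          fun i _ => hx0 i, hsum_nonneg L, le_rfl, sub_nonneg.2 hs⟩ ?_
      · rw [hU0]; linarith
      · have h3 : (∑ i ∈ U, y i) - (∑ i ∈ M, y i) + ∑ i ∈ L, y i + ∑ i ∈ R, y i +
            ((∑ i ∈ M, y i) - ∑ i ∈ S, y i) = 0 := by rw [hS]; ring
        rw [auxObjective, h3]
        simpa [extQuot, hU0] using ht0
    · set s := (∑ i ∈ S, y i) - ∑ i ∈ M, y i with hs_def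
      have hs0 : 0 < s := sub_pos.2 hs
      have hS0 : 0 < ∑ i ∈ S, y i := lt_of_le_of_lt (hsum_nonneg M) hs
      -- Keep the share `θ * y i` of each variable, with denominator `θ * y i / s`. Every ratio
      -- costs at most `s * θ * y i`, in total `s * θ * y(S) = s ^ 2`.
      set θ := s / ∑ i ∈ S, y i with hθ
      have hθ0 : 0 ≤ θ := div_nonneg hs0.le hS0.le
      have hθ1 : θ ≤ 1 := (div_le_one hS0).2 (by linarith [hsum_nonneg M])
      have hθS : θ * ∑ i ∈ S, y i = s := div_mul_cancel₀ _ hS0.ne'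
      have hyle : ∀ i ∈ R, θ * y i / s ≤ x i := fun i hi => by
        rcases hx i with h0 | h1
        · have : y i = 0 := by simpa [h0] using hxy i
          rw [this, h0]; simp
        · rw [h1, div_le_one hs0, ← hθS]
          refine mul_le_mul_of_nonneg_left ?_ hθ0
          rw [hS]
          linarith [Finset.single_le_sum (fun j _ => hy j) hi, hsum_nonneg L, hsum_nonneg U]
      have hd0 : 1 - (∑ i ∈ R, x i) - (∑ i ∈ U, x i) + (∑ i ∈ R, (x i - θ * y i / s)) + 0 =
          θ * (∑ i ∈ L, y i) / s := by
        have h1 : ∑ i ∈ R, θ * y i / s = θ * (∑ i ∈ R, y i) / s := by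
          rw [Finset.mul_sum, Finset.sum_div]
        rw [Finset.sum_sub_distrib, h1, hU0]
        field_simp
        rw [hS, hyU] at hθS
        linarith
      have hlam : ∑ i ∈ R, (1 - θ) * y i = (1 - θ) * ∑ i ∈ R, y i := (Finset.mul_sum _ _ _).symm
      have hquad : ∀ a : ℝ, (a - (1 - θ) * a) ^ 2 ≤ s * (θ * a) * (θ * a / s) := fun a => by
        refine le_of_eq ?_
        field_simp
        ring
      have hf : AuxFeasible R U x (fun i => (1 - θ) * y i) (fun i => x i - θ * y i / s)
          ((1 - θ) * ∑ i ∈ L, y i) 0 0 := by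
        refine ⟨?_, fun i _ => ?_, hU0.ge, fun i _ => mul_nonneg (sub_nonneg.2 hθ1) (hy i),
          fun i hi => sub_nonneg.2 (hyle i hi),
          mul_nonneg (sub_nonneg.2 hθ1) (hsum_nonneg L), le_rfl, le_rfl⟩
        · rw [hd0]; exact div_nonneg (mul_nonneg hθ0 (hsum_nonneg L)) hs0.le
        · exact sub_le_self _ (div_nonneg (mul_nonneg hθ0 (hy i)) hs0.le)
      refine hf.mem_certifiedSet ?_
      have h1 : extQuot (((∑ i ∈ L, y i) - (1 - θ) * ∑ i ∈ L, y i) ^ 2)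
          (1 - (∑ i ∈ R, x i) - (∑ i ∈ U, x i) + (∑ i ∈ R, (x i - θ * y i / s)) + 0) ≤
          ((s * (θ * ∑ i ∈ L, y i) : ℝ) : EReal) := by
        rw [hd0]
        exact (extQuot_le_coe_iff (sq_nonneg _)
          (div_nonneg (mul_nonneg hθ0 (hsum_nonneg L)) hs0.le)).2
          ⟨mul_nonneg hs0.le (mul_nonneg hθ0 (hsum_nonneg L)), hquad _⟩
      have h2 : ∑ i ∈ R, extQuot ((y i - (1 - θ) * y i) ^ 2) (x i - (x i - θ * y i / s)) ≤
          ((∑ i ∈ R, s * (θ * y i) : ℝ) : EReal) := by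
        rw [EReal.coe_finset_sum]
        refine Finset.sum_le_sum fun i _ => ?_
        rw [sub_sub_cancel]
        exact (extQuot_le_coe_iff (sq_nonneg _)
          (div_nonneg (mul_nonneg hθ0 (hy i)) hs0.le)).2
          ⟨mul_nonneg hs0.le (mul_nonneg hθ0 (hy i)), hquad _⟩
      have h3 : (∑ i ∈ U, y i) - (∑ i ∈ M, y i) + (1 - θ) * (∑ i ∈ L, y i) +
          (∑ i ∈ R, (1 - θ) * y i) + 0 = 0 := by
        rw [hlam, hyU]
        have h4 : (1 - θ) * ∑ i ∈ L, y i + (1 - θ) * ∑ i ∈ R, y i =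
            ∑ i ∈ S, y i - θ * ∑ i ∈ S, y i := by rw [hS, hyU]; ring
        rw [hθS] at h4
        linarith
      rw [auxObjective, h3, hU0]
      rw [hU0] at h1
      refine (add_le_add (add_le_add h1 h2) (le_of_eq (b := ((0 : ℝ) : EReal)) ?_)).trans ?_
      · simp [extQuot]
      · rw [← EReal.coe_add, ← EReal.coe_add, EReal.coe_le_coe_iff, ← Finset.mul_sum,
          ← Finset.mul_sum]
        have h5 : s * (θ * ∑ i ∈ L, y i) + s * (θ * ∑ i ∈ R, y i) = s * (θ * ∑ i ∈ S, y i) := by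
          rw [hS, hyU]; ring
        rw [hθS] at h5
        rw [h5, add_zero, ← sq]
        exact ht
  -- Some `x i` with `i ∈ U` is 1: shift all mass to the third ratio, whose denominator becomes
  -- exactly 1.
  · refine AuxFeasible.mem_certifiedSet (lam := y) (mu := x) (lam0 := ∑ i ∈ L, y i)
      (mu0 := (∑ i ∈ U, x i) - 1) (zeta := 0) ⟨by linarith, fun i _ => le_rfl, by linarith,
        fun i _ => hy i, fun i _ => hx0 i, hsum_nonneg L, by linarith, le_rfl⟩ ?_
    have h3 : (∑ i ∈ U, y i) - (∑ i ∈ M, y i) + ∑ i ∈ L, y i + ∑ i ∈ R, y i + 0 =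
        (∑ i ∈ S, y i) - ∑ i ∈ M, y i := by rw [hS]; ring
    rw [auxObjective, h3]
    simp [extQuot]
    exact_mod_cast ht

/-- The part of the hull lying over the box: a single `y k` may be nonzero where `x k = 1`. -/
lemma mem_convexHull_rankOneSet_single [Finite ι] [DecidableEq ι] {Np Nm : Finset ι} (hd : Disjoint Np Nm)
    {x : ι → ℝ} (hx : ∀ i, 0 ≤ x i ∧ x i ≤ 1) {k : ι} (hk : k ∈ Np) {c t : ℝ} (hc : 0 ≤ c)
    (hck : c = 0 ∨ x k = 1) (ht : c ^ 2 ≤ t) :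
    (x, Pi.single k c, t) ∈ convexHull ℝ (rankOneSet Np Nm) := by
  have hkm : k ∉ Nm := Finset.disjoint_left.1 hd hk
  -- The hull of a product is the product of hulls; coordinate `k` is pinned to 1 only if `c ≠ 0`.
  let B : ι → Set ℝ := fun j => if j = k ∧ c ≠ 0 then {1} else {0, 1}
  have hconv : Convex ℝ {z : ι → ℝ | (z, Pi.single k c, t) ∈ convexHull ℝ (rankOneSet Np Nm)} := by
    intro z hz z' hz' u v hu hv huv
    convert convex_convexHull ℝ (rankOneSet Np Nm) hz hz' hu hv huv using 1
    simp [← add_smul, ← add_mul, huv]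
  have hsub : Set.univ.pi B ⊆
      {z : ι → ℝ | (z, Pi.single k c, t) ∈ convexHull ℝ (rankOneSet Np Nm)} := by
    intro z hz
    have hz01 : ∀ i, z i = 0 ∨ z i = 1 := fun i => by
      have := hz i trivial
      simp only [B] at this
      split_ifs at this
      · exact Or.inr this
      · exact this
    refine subset_convexHull ℝ _ ⟨hz01, fun i => ?_, (sq_nonneg c).trans ht, ?_, fun i => ?_⟩
    · by_cases h : i = k
      · subst h; simpa using hc
      · simp [h]
    · simpa [Finset.sum_pi_single', Finset.sum_pi_single, hk, hkm] using ht
    · by_cases h : i = k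
      · subst h
        by_cases hc0 : c = 0
        · simp [hc0]
        · have := hz i trivial
          simp [B, hc0] at this
          simp [this]
      · simp [h]
  have := convexHull_min hsub hconv
  rw [convexHull_pi] at this
  refine this fun i _ => ?_
  simp only [B]
  split_ifs with h
  · rw [convexHull_singleton, h.1]
    exact hck.resolve_left h.2
  · rw [convexHull_pair, segment_eq_Icc zero_le_one]
    exact hx i

lemma mem_convexHull_rankOneSet_zero [Finite ι] {Np Nm : Finset ι}
    {x : ι → ℝ} (hx : ∀ i, 0 ≤ x i ∧ x i ≤ 1) {t : ℝ} (ht : 0 ≤ t) :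
    (x, 0, t) ∈ convexHull ℝ (rankOneSet Np Nm) := by
  have hconv : Convex ℝ {z : ι → ℝ | (z, (0 : ι → ℝ), t) ∈ convexHull ℝ (rankOneSet Np Nm)} := by
    intro z hz z' hz' u v hu hv huv
    convert convex_convexHull ℝ (rankOneSet Np Nm) hz hz' hu hv huv using 1
    simp [← add_mul, huv]
  have hsub : Set.univ.pi (fun _ : ι => ({0, 1} : Set ℝ)) ⊆
      {z : ι → ℝ | (z, (0 : ι → ℝ), t) ∈ convexHull ℝ (rankOneSet Np Nm)} := fun z hz =>
    subset_convexHull ℝ _ ⟨fun i => hz i trivial, fun i => le_rfl, ht, by simpa using ht, by simp⟩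
  have := convexHull_min hsub hconv
  rw [convexHull_pi] at this
  refine this fun i _ => ?_
  rw [convexHull_pair, segment_eq_Icc zero_le_one]
  exact hx i

/-- Disjoint events of probabilities `d i ≤ x i` on which the variables `y i` are switched on
one at a time. -/
lemma mem_convexHull_rankOneSet [Fintype ι] [DecidableEq ι] {Np Nm : Finset ι} (hdisj : Disjoint Np Nm)
    {x z d tau : ι → ℝ} {t : ℝ} (hx : ∀ i, 0 ≤ x i ∧ x i ≤ 1) (hz : ∀ i, 0 ≤ z i)
    (hout : ∀ i ∉ Np, z i = 0 ∧ d i = 0 ∧ tau i = 0) (hd : ∀ i, 0 ≤ d i) (hdx : ∀ i, d i ≤ x i)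
    (hd1 : ∑ i, d i ≤ 1) (htau0 : ∀ i, 0 ≤ tau i) (hztau : ∀ i, z i ^ 2 ≤ tau i * d i)
    (ht : ∑ i, tau i ≤ t) :
    (x, z, t) ∈ convexHull ℝ (rankOneSet Np Nm) := by
  -- The mean of `x j` outside its own event, so that `d j + (1 - d j) * ρ j = x j`. If `d j = 1`
  -- the value of `ρ j` is immaterial, as `x j = 1`.
  let ρ : ι → ℝ := fun j => (x j - d j) / (1 - d j)
  have hdle : ∀ j, d j ≤ 1 := fun j => (hdx j).trans (hx j).2
  have hρ : ∀ j, 0 ≤ ρ j ∧ ρ j ≤ 1 := fun j =>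
    ⟨div_nonneg (sub_nonneg.2 (hdx j)) (sub_nonneg.2 (hdle j)),
      div_le_one_of_le₀ (by linarith [(hx j).2]) (sub_nonneg.2 (hdle j))⟩
  have hρd : ∀ j, ρ j * (1 - d j) = x j - d j := fun j => by
    rcases eq_or_ne (1 - d j) 0 with h | h
    · rw [h, mul_zero]; linarith [hdx j, (hx j).2]
    · exact div_mul_cancel₀ _ h
  have hzd : ∀ i, d i * (z i / d i) = z i := fun i => by
    rcases eq_or_ne (d i) 0 with h | h
    · have : z i = 0 := by
        have := hztau i
        rw [h, mul_zero] at this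
        exact pow_eq_zero_iff two_ne_zero |>.1 (le_antisymm this (sq_nonneg _))
      rw [this]; simp
    · exact mul_div_cancel₀ _ h
  have hcost : ∀ i, d i * (z i / d i) ^ 2 ≤ tau i := fun i => by
    rcases eq_or_lt_of_le (hd i) with h | h
    · rw [← h]; simpa using htau0 i
    · have : d i * (z i / d i) ^ 2 = z i ^ 2 / d i := by field_simp
      rw [this, div_le_iff₀ h]
      exact hztau i
  -- Leftover cost, added to every atom so that the average is exactly `t`.
  set e : ℝ := t - ∑ i, d i * (z i / d i) ^ 2 with he
  have he0 : 0 ≤ e := sub_nonneg.2 ((Finset.sum_le_sum fun i _ => hcost i).trans ht)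
  let w : Option ι → ℝ := fun o => o.elim (1 - ∑ i, d i) d
  let P : Option ι → (ι → ℝ) × (ι → ℝ) × ℝ := fun o =>
    o.elim (ρ, 0, e) fun k => (Function.update ρ k 1, Pi.single k (z k / d k), (z k / d k) ^ 2 + e)
  have hw : ∀ o ∈ (Finset.univ : Finset (Option ι)), 0 ≤ w o := by
    rintro (_ | k) -
    · exact sub_nonneg.2 hd1
    · exact hd k
  have hw1 : ∑ o, w o = 1 := by rw [Fintype.sum_option]; simp [w]
  have hP : ∀ o ∈ (Finset.univ : Finset (Option ι)), P o ∈ convexHull ℝ (rankOneSet Np Nm) := by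
    rintro (_ | k) -
    · exact mem_convexHull_rankOneSet_zero hρ he0
    · have hbox : ∀ i, 0 ≤ Function.update ρ k 1 i ∧ Function.update ρ k 1 i ≤ 1 := fun i => by
        by_cases h : i = k
        · subst h; simp
        · simpa [h] using hρ i
      by_cases hk : k ∈ Np
      · exact mem_convexHull_rankOneSet_single hdisj hbox hk (div_nonneg (hz k) (hd k))
          (Or.inr (by simp)) (le_add_of_nonneg_right he0)
      · have hk0 : z k = 0 := (hout k hk).1
        simpa [P, hk0] using mem_convexHull_rankOneSet_zero hbox he0
  have := (convex_convexHull ℝ (rankOneSet Np Nm)).sum_mem hw hw1 hP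
  convert this using 1
  rw [Fintype.sum_option]
  refine Prod.ext ?_ (Prod.ext ?_ ?_)
  · funext j
    simp only [w, P, Option.elim, Prod.fst_add, Prod.smul_fst, Prod.fst_sum, Pi.add_apply,
      Finset.sum_apply, Pi.smul_apply, smul_eq_mul]
    have : ∀ k, d k * Function.update ρ k 1 j = d k * ρ j + if k = j then d j * (1 - ρ j) else 0 :=
      fun k => by
        by_cases h : k = j
        · subst h; simp; ring
        · simp [h, Function.update_of_ne (Ne.symm h)]
    rw [Finset.sum_congr rfl fun k _ => this k, Finset.sum_add_distrib, ← Finset.sum_mul]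
    simp only [Finset.sum_ite_eq', Finset.mem_univ, if_true]
    linarith [hρd j]
  · funext j
    simp only [w, P, Option.elim, Prod.fst_add, Prod.snd_add, Prod.smul_fst, Prod.smul_snd,
      Prod.fst_sum, Prod.snd_sum, Pi.add_apply,
      Finset.sum_apply, Pi.smul_apply, smul_eq_mul, Pi.zero_apply, mul_zero, zero_add]
    rw [Finset.sum_eq_single j]
    · simp [hzd]
    · intro k _ hkj; simp [Ne.symm hkj]
    · simp
  · simp only [w, P, Option.elim, Prod.snd_add, Prod.smul_snd, Prod.snd_sum, smul_eq_mul, mul_add,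
      Finset.sum_add_distrib, ← Finset.sum_mul]
    rw [he]; ring

/-- Adding a balanced nonnegative vector to `y` does not leave the closed convex hull. -/
lemma add_balanced_mem_closure {Np Nm : Finset ι} {x z r : ι → ℝ} {t : ℝ}
    (h : (x, z, t) ∈ closure (convexHull ℝ (rankOneSet Np Nm))) (hr : ∀ i, 0 ≤ r i)
    (hbal : ∑ i ∈ Np, r i = ∑ i ∈ Nm, r i) :
    (x, z + r, t) ∈ closure (convexHull ℝ (rankOneSet Np Nm)) := by
  -- Weight `1 / (n + 1)` on the point `(1, (n + 1) r, 0)` of `X` contributes exactly `r` to `y`,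
  -- and nothing else in the limit.
  let ε : ℕ → ℝ := fun n => 1 / ((n : ℝ) + 1)
  have hε : Tendsto ε atTop (𝓝 0) := tendsto_one_div_add_atTop_nhds_zero_nat
  have hmem : ∀ n, (1 - ε n) • (x, z, t) + ε n • ((1 : ι → ℝ), ((n : ℝ) + 1) • r, (0 : ℝ)) ∈
      closure (convexHull ℝ (rankOneSet Np Nm)) := fun n => by
    have hn : (0 : ℝ) < (n : ℝ) + 1 := by positivity
    have h1 : ε n ≤ 1 := by
      simp only [ε]; rw [div_le_one hn]; linarith [(Nat.cast_nonneg n : (0 : ℝ) ≤ n)]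
    refine (convex_convexHull ℝ _).closure h (subset_closure (subset_convexHull ℝ _ ?_))
      (sub_nonneg.2 h1) (by positivity) (by ring)
    refine ⟨fun i => Or.inr rfl, fun i => mul_nonneg hn.le (hr i), le_rfl, ?_, fun i => by simp⟩
    simp [← Finset.mul_sum, hbal]
  refine isClosed_closure.mem_of_tendsto (b := atTop) ?_ (Eventually.of_forall hmem)
  have heq : ∀ n, (1 - ε n) • (x, z, t) + ε n • ((1 : ι → ℝ), ((n : ℝ) + 1) • r, (0 : ℝ)) =
      (1 - ε n) • (x, z, t) + ε n • ((1 : ι → ℝ), (0 : ι → ℝ), (0 : ℝ)) + (0, r, 0) := fun n => by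
    have hn : ε n * ((n : ℝ) + 1) = 1 := by
      simp only [ε]; field_simp
    simp [smul_smul, hn]
  simp_rw [heq]
  have hlim : Tendsto (fun n => (1 - ε n) • (x, z, t) +
      ε n • ((1 : ι → ℝ), (0 : ι → ℝ), (0 : ℝ)) + ((0 : ι → ℝ), r, (0 : ℝ))) atTop
      (𝓝 ((1 - (0 : ℝ)) • (x, z, t) + (0 : ℝ) • ((1 : ι → ℝ), (0 : ι → ℝ), (0 : ℝ)) +
        ((0 : ι → ℝ), r, (0 : ℝ)))) :=
    (((tendsto_const_nhds.sub hε).smul tendsto_const_nhds).add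
      (hε.smul tendsto_const_nhds)).add tendsto_const_nhds
  simpa using hlim

/-- The inequality with `R` the whole side of larger total already cuts out the hull. -/
lemma mem_closure_of_certified [Fintype ι] [DecidableEq ι] {Np Nm : Finset ι}
    (hdisj : Disjoint Np Nm) {x y : ι → ℝ} {t : ℝ} (hx : ∀ i, 0 ≤ x i ∧ x i ≤ 1)
    (hy : ∀ i, 0 ≤ y i) (hs : ∑ i ∈ Nm, y i ≤ ∑ i ∈ Np, y i)
    (h : (x, y, t) ∈ certifiedSet Nm ∅ Np ∅) :
    (x, y, t) ∈ closure (convexHull ℝ (rankOneSet Np Nm)) := by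
  obtain ⟨lam, mu, tau, lam0, mu0, zeta, t0, tU, hf, hout, hR, h0, -, hU, hU', ht⟩ := h
  have hmu0 : mu0 = 0 := le_antisymm (by simpa using hf.mu0_le) hf.mu0_nonneg
  have hd1 := hf.denom_nonneg
  simp only [Finset.sum_empty, hmu0, sub_zero, mul_zero, zero_sub, add_zero] at hU' hd1
  have hthird := pow_eq_zero_iff two_ne_zero |>.1 (le_antisymm hU' (sq_nonneg _))
  have hlam : ∑ i ∈ Np, lam i ≤ ∑ i ∈ Nm, y i := by
    linarith [hf.lam0_nonneg, hf.zeta_nonneg]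
  simp only at ht hR hlam hd1
  set s := ∑ i ∈ Np, y i - ∑ i ∈ Nm, y i with hs_def
  have hs0 : 0 ≤ s := sub_nonneg.2 hs
  -- Positive parts are needed since `λ i` may exceed `y i`. Their total is at least `s`, so scaling
  -- by `s / P ≤ 1` keeps both `z ≤ y` and the cone bounds.
  set P := ∑ i ∈ Np, max (y i - lam i) 0 with hP
  have hsP : s ≤ P := by
    have : ∑ i ∈ Np, (y i - lam i) ≤ P := Finset.sum_le_sum fun i _ => le_max_left _ _
    rw [Finset.sum_sub_distrib] at this
    linarith
  have hθ0 : 0 ≤ s / P := div_nonneg hs0 (hs0.trans hsP)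
  have hθ1 : s / P ≤ 1 := div_le_one_of_le₀ hsP (hs0.trans hsP)
  have hθP : s / P * P = s := by
    rcases eq_or_ne P 0 with h | h
    · rw [h, mul_zero]; linarith
    · exact div_mul_cancel₀ _ h
  let z : ι → ℝ := fun i => if i ∈ Np then s / P * max (y i - lam i) 0 else 0
  have hz0 : ∀ i, 0 ≤ z i := fun i => by
    simp only [z]; split_ifs
    · exact mul_nonneg hθ0 (le_max_right _ _)
    · exact le_rfl
  have hzy : ∀ i, z i ≤ y i := fun i => by
    simp only [z]; split_ifs with hi
    · exact (mul_le_of_le_one_left (le_max_right _ _) hθ1).trans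
        (max_le (sub_le_self _ (hf.lam_nonneg i hi)) (hy i))
    · exact hy i
  have hzsum : ∑ i ∈ Np, z i = s := by
    rw [← hθP, hP, Finset.mul_sum]
    exact Finset.sum_congr rfl fun i hi => if_pos hi
  have hzm : ∑ i ∈ Nm, z i = 0 := Finset.sum_eq_zero fun i hi =>
    if_neg (Finset.disjoint_right.1 hdisj hi)
  have htau0 : ∀ i, 0 ≤ tau i := fun i => by
    by_cases hi : i ∈ Np
    · exact (hR i hi).1
    · rw [(hout i hi).2.2]
  have hq : (x, z, t) ∈ convexHull ℝ (rankOneSet Np Nm) := by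
    refine mem_convexHull_rankOneSet hdisj (d := fun i => if i ∈ Np then x i - mu i else 0)
      (tau := tau) hx hz0 (fun i hi => ⟨if_neg hi, if_neg hi, (hout i hi).2.2⟩) (fun i => ?_)
      (fun i => ?_) ?_ htau0 (fun i => ?_) ?_
    · split_ifs with hi
      · exact sub_nonneg.2 (hf.mu_le i hi)
      · exact le_rfl
    · split_ifs with hi
      · exact sub_le_self _ (hf.mu_nonneg i hi)
      · exact (hx i).1
    · rw [Finset.sum_ite_mem, Finset.univ_inter, Finset.sum_sub_distrib]
      linarith
    · simp only [z]
      split_ifs with hi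
      · refine le_trans ?_ (hR i hi).2
        refine sq_le_sq.2 ?_
        rw [abs_of_nonneg (mul_nonneg hθ0 (le_max_right _ _))]
        exact (mul_le_of_le_one_left (le_max_right _ _) hθ1).trans
          (max_le (le_abs_self _) (abs_nonneg _))
      · simp
    · rw [← Finset.sum_subset (Finset.subset_univ Np) fun i _ hi => (hout i hi).2.2]
      linarith
  have := add_balanced_mem_closure (subset_closure hq) (r := y - z)
    (fun i => sub_nonneg.2 (hzy i)) (by
      simp only [Pi.sub_apply, Finset.sum_sub_distrib, hzsum, hzm]
      linarith)
  simpa using this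

/-- `S` and `M` are kept apart from `Np` and `Nm` so that both families follow, `X` being symmetric
in the two sides. -/
lemma closure_convexHull_subset [Finite ι] [DecidableEq ι] {Np Nm M S L R U : Finset ι}
    (hX : rankOneSet Np Nm = rankOneSet S M) (h : IsTripartition S L R U) :
    closure (convexHull ℝ (rankOneSet Np Nm)) ⊆
      {p | ((∀ i, 0 ≤ p.1 i) ∧ ∀ i, 0 ≤ p.2.1 i) ∧ p ∈ certifiedSet M L R U} := by
  refine closure_minimal (convexHull_min ?_ ?_) (isClosed_certifiedSet M L R U)
  · intro p hp
    refine ⟨⟨fun i => ?_, hp.2.1⟩, rankOneSet_subset_certifiedSet h (hX ▸ hp)⟩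
    rcases hp.1 i with h | h <;> rw [h]
    exact zero_le_one
  · refine Convex.inter ?_ (convex_certifiedSet M L R U)
    intro p hp q hq u v hu hv _
    exact ⟨fun i => add_nonneg (mul_nonneg hu (hp.1 i)) (mul_nonneg hv (hq.1 i)),
      fun i => add_nonneg (mul_nonneg hu (hp.2 i)) (mul_nonneg hv (hq.2 i))⟩

lemma closure_convexHull_fst_le_one {Np Nm : Finset ι} {p : (ι → ℝ) × (ι → ℝ) × ℝ}
    (hp : p ∈ closure (convexHull ℝ (rankOneSet Np Nm))) (i : ι) : p.1 i ≤ 1 := by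
  have hsub : closure (convexHull ℝ (rankOneSet Np Nm)) ⊆
      {p : (ι → ℝ) × (ι → ℝ) × ℝ | p.1 i ≤ 1} := by
    refine closure_minimal (convexHull_min ?_ ?_) (isClosed_le (by fun_prop) (by fun_prop))
    · intro q hq
      show q.1 i ≤ 1
      rcases hq.1 i with h | h <;> rw [h]
      exact zero_le_one
    · intro a ha b hb u v hu hv huv
      show u * a.1 i + v * b.1 i ≤ 1
      nlinarith [mul_le_mul_of_nonneg_left (show a.1 i ≤ 1 from ha) hu,
        mul_le_mul_of_nonneg_left (show b.1 i ≤ 1 from hb) hv]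
  exact hsub hp

end Hull

theorem mainTheorem1 {ι : Type*} [Fintype ι] [DecidableEq ι] (Np Nm : Finset ι)
    (hdisj : Disjoint Np Nm) (hunion : Np ∪ Nm = Finset.univ) :
    closure (convexHull ℝ (rankOneSet Np Nm)) =
      {p : (ι → ℝ) × (ι → ℝ) × ℝ |
        (∀ i, 0 ≤ p.1 i ∧ p.1 i ≤ 1) ∧ (∀ i, 0 ≤ p.2.1 i) ∧
        (∀ L R U : Finset ι, IsTripartition Np L R U →
          ExtendedIneq Nm L R U p.1 p.2.1 p.2.2) ∧
        (∀ L R U : Finset ι, IsTripartition Nm L R U →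
          ExtendedIneq Np L R U p.1 p.2.1 p.2.2)} := by
  have htri : ∀ S : Finset ι, IsTripartition S ∅ S ∅ := fun S =>
    ⟨by simp, by simp, by simp, by simp⟩
  refine Set.Subset.antisymm (fun p hp => ?_) ?_
  · obtain ⟨⟨hx, hy⟩, -⟩ := closure_convexHull_subset rfl (htri Np) hp
    refine ⟨fun i => ⟨hx i, closure_convexHull_fst_le_one hp i⟩, hy, fun L R U h => ?_,
      fun L R U h => ?_⟩
    · exact (extendedIneq_iff hx hy).2 (closure_convexHull_subset rfl h hp).2
    · exact (extendedIneq_iff hx hy).2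
        (closure_convexHull_subset (rankOneSet_comm Np Nm) h hp).2
  · rintro ⟨x, y, t⟩ ⟨hx, hy, hp, hm⟩
    rcases le_total (∑ i ∈ Nm, y i) (∑ i ∈ Np, y i) with hs | hs
    · exact mem_closure_of_certified hdisj hx hy hs
        ((extendedIneq_iff (fun i => (hx i).1) hy).1 (hp _ _ _ (htri Np)))
    · rw [rankOneSet_comm]
      exact mem_closure_of_certified hdisj.symm hx hy hs
        ((extendedIneq_iff (fun i => (hx i).1) hy).1 (hm _ _ _ (htri Nm)))
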